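/- Let $0<x<1$. A REM$_x$ process is a Poisson point process on $[0,\infty)$ with intensity measure $\rho_x(d\xi)=-d(\xi^{-x})=x\,\xi^{-x-1}\,d\xi$ on $(0,\infty)$; almost surely it has countably infinitely many points, and $Z_x$ denotes a random variable distributed as the sum of the points of a REM$_x$ process (its partition function). Let $k\ge 2$ and $0<x_1<x_2<\dots<x_k<1$. For every $n=1,\dots,k$ and every address $(\alpha_1,\dots,\alpha_{n-1})\in\mathbb N^{n-1}$ let $\{\xi^{(n)}_{\alpha_n;\alpha_1,\dots,\alpha_{n-1}}\}_{\alpha_n\in\mathbb N}$ be a labelled REM$_{x_n}$ process, all these labelled processes (over all levels $n$ and all addresses) being independent. For $\underline\alpha=(\alpha_1,\dots,\alpha_k)\in\mathbb N^k$ put $$\xi_{\underline\alpha}=\prod_{n=1}^k \xi^{(n)}_{\alpha_n;\alpha_1,\dots,\alpha_{n-1}},\qquad Z=\sum_{\underline\alpha\in\mathbb N^k}\xi_{\underline\alpha}.$$ **Theorem.** Almost surely $0<Z<\infty$, and in distribution $$Z\ \stackrel{\mathcal D}{=}\ Z_{x_1}\,\prod_{n=2}^{k}\Big(\mathbb E\big[(Z_{x_n})^{x_{n-1}}\big]\Big)^{1/x_{n-1}}.$$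 In particular $\log Z$ is integrable, so that $\mathbb E(\log Z)<\infty$. -/

import Mathlib

open MeasureTheory ProbabilityTheory
open scoped NNReal ENNReal

noncomputable section

/-- The occupation number `N_A`: how many labels `n` have their point `p n` in `A`. -/
def occupation (p : ℕ → ℝ≥0) (A : Set ℝ≥0) : ℕ∞ := {n | p n ∈ A}.encard

/-- A Poisson point process on `[0, ∞)` with intensity measure `ρ` of infinite mass (so that there
are infinitely many points), given through a measurable labelling `p ω 0, p ω 1, …` of its points (in no particular order): occupation numbers
of measurable sets are Poisson with mean `ρ A`, and those of disjoint sets are independent. -/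
structure IsPoissonProcess {Ω : Type*} [MeasurableSpace Ω] (P : Measure Ω) (ρ : Measure ℝ≥0)
    (p : Ω → ℕ → ℝ≥0) : Prop where
  measurable : Measurable p
  poisson : ∀ A : Set ℝ≥0, MeasurableSet A → ρ A ≠ ∞ → ∀ j : ℕ,
    P {ω | occupation (p ω) A = j} = poissonMeasure (ρ A).toNNReal {j}
  poisson_top : ∀ A : Set ℝ≥0, MeasurableSet A → ρ A = ∞ → ∀ᵐ ω ∂P, occupation (p ω) A = ⊤
  indep : ∀ (m : ℕ) (A : Fin m → Set ℝ≥0), (∀ i, MeasurableSet (A i)) →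
    (∀ i j, i ≠ j → Disjoint (A i) (A j)) → iIndepFun (fun i ω => occupation (p ω) (A i)) P

/-- The measure `-d(ξ ^ (-x)) = x ξ ^ (-x - 1) dξ` on `[0, ∞)`: the measure with this density on
the positive half-line, transported to `ℝ≥0`. -/
def remIntensity (x : ℝ) : Measure ℝ≥0 :=
  ((volume.restrict (Set.Ioi (0 : ℝ))).withDensity
    fun t => ENNReal.ofReal (x * t ^ (-x - 1))).map Real.toNNReal

/-- `p` is (a labelling of the points of) a `REM_x` process. -/
def IsREM {Ω : Type*} [MeasurableSpace Ω] (P : Measure Ω) (x : ℝ) (p : Ω → ℕ → ℝ≥0) : Prop :=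
  IsPoissonProcess P (remIntensity x) p

/-- The partition function of a point configuration: the sum of its points, in `[0, ∞]`. -/
def remPartition (p : ℕ → ℝ≥0) : ℝ≥0∞ := ∑' n, (p n : ℝ≥0∞)

/-- The hierarchical construction with `k` levels and parameters `x 1, …, x k`. Levels are counted
from `0` in `Fin k`; an address preceding level `n` is a tuple in `Fin n → ℕ`, and
`ξ n a ω j` is the point with label `j` of the process attached to the address `a`.
The process at each address of level `n` is a REM with parameter `x (n + 1)`, and all these
processes, for all levels and addresses, are independent. -/
structure IsCascade {Ω : Type*} [MeasurableSpace Ω] (P : Measure Ω) (k : ℕ) (x : ℕ → ℝ)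
    (ξ : (n : Fin k) → (Fin n → ℕ) → Ω → ℕ → ℝ≥0) : Prop where
  isREM : ∀ (n : Fin k) (a : Fin n → ℕ), IsREM P (x (n + 1)) (ξ n a)
  indep : iIndepFun (fun (a : Σ n : Fin k, (Fin n → ℕ)) (ω : Ω) => ξ a.1 a.2 ω) P

/-- The point `ξ_α = ∏ n, ξ^(n)_{α_n; α_1, …, α_{n-1}}` of the cascade. -/
def cascadePoint {Ω : Type*} {k : ℕ} (ξ : (n : Fin k) → (Fin n → ℕ) → Ω → ℕ → ℝ≥0)
    (ω : Ω) (α : Fin k → ℕ) : ℝ≥0 :=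
  ∏ n : Fin k, ξ n (fun i => α (Fin.castLE n.isLt.le i)) ω (α n)

/-- The partition function of the cascade, the sum of `ξ_α` over all addresses, in `[0, ∞]`. -/
def cascadePartition {Ω : Type*} {k : ℕ} (ξ : (n : Fin k) → (Fin n → ℕ) → Ω → ℕ → ℝ≥0)
    (ω : Ω) : ℝ≥0∞ :=
  ∑' α : Fin k → ℕ, (cascadePoint ξ ω α : ℝ≥0∞)

end

/-! Laws on `[0, ∞]` are compared through their Laplace transforms. A Poisson process of intensity
`ρ` satisfies `E exp (-∑ f(points)) = exp (-∫ (1 - e^{-f}) dρ)`. Dilating the points of a REM_x by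
`w` multiplies `ρ_x` by `w ^ x`, so `∫ (1 - e^{-sw}) ρ_x(ds) = c_x w ^ x` and `E exp (-t Z_x) = exp
(-c_x t ^ x)`. If the points `ξ_j` carry i.i.d. weights `W_j` independent of them, averaging over
the weights gives `exp (-c_x t ^ x E[W ^ x])`; thus `∑ ξ_j W_j` has the law of `E[W ^ x] ^ (1/x)
Z_x` (`IsREM.laplace_marked`).

A cascade has this form: `Z = ∑ ξ_j Z^(j)`, where the `Z^(j)` are the i.i.d. partition functions of
the cascades below the first-level points. Inductively `Z^(j)` is `Z_{x_2}` times a constant in law,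
which produces the factor `E[Z_{x_2} ^ x_1] ^ (1/x_1)` (`IsCascade.map_cascadePartition`).

The induction runs in `[0, ∞]` and needs no finiteness. The ordering of the parameters serves to
make the moments finite: `c_y E[Z_x ^ y] = ∫ (1 - exp (-c_x s ^ x)) ρ_y(ds)` is finite for `y < x <
1`. Integrability of `log Z_x` follows from such a moment and from `E[1 / Z_x] = ∫ exp (-c_x t ^ x)
dt < ∞`. -/

/-! ### The decaying exponential on `[0, ∞]`. -/

/-- The function `z ↦ exp (-z)` on `[0, ∞]`, with `exp (-∞) = 0`. -/
noncomputable def expNeg (z : ℝ≥0∞) : ℝ≥0∞ := (EReal.exp z)⁻¹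

@[simp] lemma expNeg_zero : expNeg 0 = 1 := by simp [expNeg]

@[simp] lemma expNeg_top : expNeg ∞ = 0 := by simp [expNeg]

lemma expNeg_coe (z : ℝ≥0) : expNeg z = ENNReal.ofReal (Real.exp (-z)) := by
  rw [expNeg, EReal.coe_nnreal_eq_coe_real, EReal.exp_coe, Real.exp_neg,
    ENNReal.ofReal_inv_of_pos (Real.exp_pos _)]

lemma expNeg_ofReal {z : ℝ} (hz : 0 ≤ z) :
    expNeg (ENNReal.ofReal z) = ENNReal.ofReal (Real.exp (-z)) := by
  rw [ENNReal.ofReal, expNeg_coe, Real.coe_toNNReal _ hz]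

lemma expNeg_le_one (z : ℝ≥0∞) : expNeg z ≤ 1 := by
  rw [expNeg, ENNReal.inv_le_one, EReal.one_le_exp_iff]
  exact EReal.coe_ennreal_nonneg z

lemma expNeg_ne_top (z : ℝ≥0∞) : expNeg z ≠ ∞ :=
  ((expNeg_le_one z).trans_lt ENNReal.one_lt_top).ne

lemma expNeg_strictAnti : StrictAnti expNeg := fun a b h => by
  rw [expNeg, expNeg, ENNReal.inv_lt_inv, EReal.exp_lt_exp_iff]
  exact EReal.coe_ennreal_lt_coe_ennreal_iff.2 h

lemma continuous_expNeg : Continuous expNeg := by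
  unfold expNeg
  have : Continuous EReal.exp := by fun_prop
  exact (this.comp continuous_coe_ennreal_ereal).inv

@[fun_prop] lemma measurable_expNeg : Measurable expNeg := continuous_expNeg.measurable

lemma expNeg_add (a b : ℝ≥0∞) : expNeg (a + b) = expNeg a * expNeg b := by
  induction a with
  | top => simp
  | coe a => induction b with
    | top => simp
    | coe b =>
      rw [← ENNReal.coe_add, expNeg_coe, expNeg_coe, expNeg_coe,
        ← ENNReal.ofReal_mul (Real.exp_pos _).le, ← Real.exp_add]
      congr 2; push_cast; ring

lemma expNeg_sum {ι : Type*} (s : Finset ι) (f : ι → ℝ≥0∞) :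
    expNeg (∑ i ∈ s, f i) = ∏ i ∈ s, expNeg (f i) := by
  classical
  induction s using Finset.induction_on with
  | empty => simp
  | insert a s ha ih => rw [Finset.sum_insert ha, Finset.prod_insert ha, expNeg_add, ih]

lemma expNeg_mul_natCast (c : ℝ≥0∞) (n : ℕ) : expNeg (c * n) = expNeg c ^ n := by
  induction n with
  | zero => simp
  | succ n ih => rw [Nat.cast_succ, mul_add, mul_one, expNeg_add, ih, pow_succ]

lemma tendsto_prod_expNeg (f : ℕ → ℝ≥0∞) :
    Filter.Tendsto (fun N => ∏ n ∈ Finset.range N, expNeg (f n)) Filter.atTop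
      (nhds (expNeg (∑' n, f n))) := by
  simp_rw [← expNeg_sum]
  exact (continuous_expNeg.tendsto _).comp (ENNReal.tendsto_nat_tsum f)

/-- The inverse of `expNeg` on `[0, 1]`. -/
noncomputable def negLog (u : ℝ≥0∞) : ℝ≥0∞ := (-ENNReal.log u).toENNReal

@[fun_prop] lemma measurable_negLog : Measurable negLog :=
  (ENNReal.measurable_log.neg).ereal_toENNReal

lemma expNeg_negLog {u : ℝ≥0∞} (hu : u ≤ 1) : expNeg (negLog u) = u := by
  have h : ENNReal.log u ≤ 0 := by simpa using ENNReal.log_monotone hu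
  rw [expNeg, negLog, EReal.coe_toENNReal (by simpa using EReal.neg_le_neg_iff.2 h), EReal.exp_neg,
    inv_inv, ENNReal.exp_log]

lemma one_sub_expNeg_eq_zero {z : ℝ≥0∞} : 1 - expNeg z = 0 ↔ z = 0 := by
  rw [tsub_eq_zero_iff_le, ← expNeg_zero, expNeg_strictAnti.le_iff_ge, nonpos_iff_eq_zero]

lemma one_sub_expNeg_le (z : ℝ≥0∞) : 1 - expNeg z ≤ z := by
  induction z with
  | top => simp
  | coe z =>
    rw [expNeg_coe, ← ENNReal.ofReal_one, ← ENNReal.ofReal_sub _ (Real.exp_pos _).le]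
    refine (ENNReal.ofReal_le_ofReal (q := z) ?_).trans (by simp)
    linarith [Real.add_one_le_exp (-(z : ℝ))]

lemma lintegral_one_sub_expNeg {Ω : Type*} [MeasurableSpace Ω] {P : Measure Ω}
    [IsProbabilityMeasure P] {X : Ω → ℝ≥0∞} (hX : Measurable X) :
    ∫⁻ ω, (1 - expNeg (X ω)) ∂P = 1 - ∫⁻ ω, expNeg (X ω) ∂P := by
  rw [lintegral_sub (by fun_prop) _ (ae_of_all _ fun _ => expNeg_le_one _)]
  · simp
  · refine ((lintegral_mono fun ω => expNeg_le_one (X ω)).trans_lt ?_).ne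
    simp

lemma lintegral_expNeg_le_one {Ω : Type*} [MeasurableSpace Ω] {P : Measure Ω}
    [IsProbabilityMeasure P] (X : Ω → ℝ≥0∞) : ∫⁻ ω, expNeg (X ω) ∂P ≤ 1 :=
  (lintegral_mono fun ω => expNeg_le_one (X ω)).trans (by simp)

/-! ### Laplace transforms determine laws. -/

/-- A finite measure on `[0, ∞]` is determined by its Laplace transform. -/
lemma Measure.ext_of_laplace {μ ν : Measure ℝ≥0∞} [IsFiniteMeasure μ] [IsFiniteMeasure ν]
    (h : ∀ t, ∫⁻ z, expNeg (t * z) ∂μ = ∫⁻ z, expNeg (t * z) ∂ν) : μ = ν := by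
  let f : BoundedContinuousFunction ℝ≥0∞ ℝ := BoundedContinuousFunction.mkOfCompact
    ⟨fun z => (expNeg z).toReal, by
      refine continuous_iff_continuousAt.2 fun z => ?_
      exact (ENNReal.continuousAt_toReal (expNeg_ne_top z)).comp continuous_expNeg.continuousAt⟩
  have hf (z : ℝ≥0∞) : f z = (expNeg z).toReal := rfl
  have hs (a : BoundedContinuousFunction ℝ≥0∞ ℝ) : star a = a := by ext; simp
  -- Polynomials in `e^{-z}` separate the points of the compact space `[0, ∞]`, and the integral of
  -- `e^{-nz}` is the Laplace transform at the integer `n`.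
  let A : StarSubalgebra ℝ (BoundedContinuousFunction ℝ≥0∞ ℝ) :=
    { Algebra.adjoin ℝ {f} with star_mem' := fun {a} ha => by rwa [hs a] }
  have key (n : ℕ) (μ : Measure ℝ≥0∞) [IsFiniteMeasure μ] :
      ∫ z, f z ^ n ∂μ = (∫⁻ z, expNeg (n * z) ∂μ).toReal := by
    rw [← integral_toReal (by fun_prop) (ae_of_all _ fun z => (expNeg_ne_top _).lt_top)]
    simp_rw [mul_comm (n : ℝ≥0∞), expNeg_mul_natCast, ENNReal.toReal_pow, hf]
  refine ext_of_forall_mem_subalgebra_integral_eq_of_polish (𝕜 := ℝ) (A := A) ?_ ?_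
  · intro a b hab
    refine ⟨_, ⟨_, ⟨f, Algebra.subset_adjoin rfl, rfl⟩, rfl⟩, ?_⟩
    intro hc
    apply hab
    apply expNeg_strictAnti.injective
    exact (ENNReal.toReal_eq_toReal_iff' (expNeg_ne_top _) (expNeg_ne_top _)).1 hc
  · intro g hg
    have hg' : g ∈ Algebra.adjoin ℝ {f} := hg
    rw [Algebra.adjoin_singleton_eq_range_aeval] at hg'
    obtain ⟨q, rfl⟩ := hg'
    induction q using Polynomial.induction_on' with
    | add p q hp hq =>
      have mem (p : Polynomial ℝ) : Polynomial.aeval f p ∈ A := by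
        change _ ∈ Algebra.adjoin ℝ {f}
        rw [Algebra.adjoin_singleton_eq_range_aeval]
        exact ⟨p, rfl⟩
      have hp := hp (mem p)
      have hq := hq (mem q)
      simp only [AlgHom.toRingHom_eq_coe, RingHom.coe_coe, map_add,
        BoundedContinuousFunction.coe_add, Pi.add_apply] at hp hq ⊢
      rw [integral_add (BoundedContinuousFunction.integrable _ _)
        (BoundedContinuousFunction.integrable _ _), integral_add
        (BoundedContinuousFunction.integrable _ _) (BoundedContinuousFunction.integrable _ _),
        hp, hq]
    | monomial n a =>
      have e (z : ℝ≥0∞) : (Polynomial.aeval f (Polynomial.monomial n a)) z = a * f z ^ n := by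
        rw [Polynomial.aeval_monomial]
        simp
      simp only [AlgHom.toRingHom_eq_coe, RingHom.coe_coe, e, integral_const_mul, key, h]

/-! ### Laplace functional of a Poisson process. -/

/-- The counting measure of a labelled point configuration. -/
noncomputable def countingMeasure (p : ℕ → ℝ≥0) : Measure ℝ≥0 :=
  Measure.sum fun n => Measure.dirac (p n)

lemma lintegral_countingMeasure (p : ℕ → ℝ≥0) {f : ℝ≥0 → ℝ≥0∞} (hf : Measurable f) :
    ∫⁻ s, f s ∂(countingMeasure p) = ∑' n, f (p n) := by
  simp [countingMeasure, lintegral_sum_measure, lintegral_dirac' _ hf]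

lemma countingMeasure_apply (p : ℕ → ℝ≥0) {A : Set ℝ≥0} (hA : MeasurableSet A) :
    countingMeasure p A = (occupation p A : ℝ≥0∞) := by
  rw [countingMeasure, Measure.sum_apply _ hA, occupation, ← ENNReal.tsum_set_one,
    tsum_subtype {n | p n ∈ A} (fun _ => (1 : ℝ≥0∞))]
  refine tsum_congr fun n => ?_
  simp [Measure.dirac_apply' _ hA, Set.indicator]

lemma tsum_poisson (r : ℝ≥0) (c : ℝ≥0∞) :
    ∑' n : ℕ, poissonMeasure r {n} * expNeg (c * n) = expNeg (r * (1 - expNeg c)) := by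
  obtain ⟨q, hq⟩ : ∃ q : ℝ≥0, (q : ℝ≥0∞) = expNeg c := ⟨_, ENNReal.coe_toNNReal (expNeg_ne_top c)⟩
  have hq1 : q ≤ 1 := by
    have := expNeg_le_one c
    rw [← hq] at this
    exact_mod_cast this
  have h1 (n : ℕ) : poissonMeasure r {n} * expNeg (c * n) =
      ENNReal.ofReal (Real.exp (-r) * ((r * q) ^ n / n.factorial)) := by
    rw [poissonMeasure_singleton, expNeg_mul_natCast, ← hq, ← ENNReal.ofReal_coe_nnreal (p := q),
      ← ENNReal.ofReal_pow (by positivity), ← ENNReal.ofReal_mul (by positivity)]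
    congr 1
    rw [mul_pow]; ring
  have h2 : HasSum (fun n : ℕ => Real.exp (-r) * (((r : ℝ) * q) ^ n / n.factorial))
      (Real.exp (-r) * Real.exp (r * q)) := by
    have := NormedSpace.expSeries_div_hasSum_exp ((r : ℝ) * q)
    rw [← Real.exp_eq_exp_ℝ] at this
    exact this.mul_left _
  simp_rw [h1]
  rw [← ENNReal.ofReal_tsum_of_nonneg (fun n => by positivity) h2.summable, h2.tsum_eq, ← hq,
    ← ENNReal.coe_one, ← ENNReal.coe_sub, ← ENNReal.coe_mul, expNeg_coe, ← Real.exp_add]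
  congr 2
  rw [NNReal.coe_mul, NNReal.coe_sub hq1]
  push_cast; ring

namespace IsPoissonProcess

variable {Ω : Type*} [MeasurableSpace Ω] {P : Measure Ω} {ρ : Measure ℝ≥0} {p : Ω → ℕ → ℝ≥0}

lemma measurable_tsum (hp : IsPoissonProcess P ρ p) {f : ℝ≥0 → ℝ≥0∞} (hf : Measurable f) :
    Measurable fun ω => ∑' n, f (p ω n) :=
  Measurable.tsum fun n => hf.comp ((measurable_pi_apply n).comp hp.measurable)

lemma measurable_occupation (hp : IsPoissonProcess P ρ p) {A : Set ℝ≥0} (hA : MeasurableSet A) :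
    Measurable fun ω => occupation (p ω) A := by
  have h : Measurable fun ω => (occupation (p ω) A : ℝ≥0∞) := by
    simp_rw [← countingMeasure_apply _ hA, ← lintegral_indicator_one hA]
    simp_rw [lintegral_countingMeasure _ (measurable_one.indicator hA)]
    exact hp.measurable_tsum (measurable_one.indicator hA)
  refine measurable_to_countable' fun j => ?_
  convert! h (measurableSet_singleton (j : ℝ≥0∞)) using 1
  ext ω
  simp

/-- For infinite `ρ A` both sides vanish, except at `c = 0` where both are 1. -/
lemma lintegral_expNeg_occupation [IsProbabilityMeasure P] (hp : IsPoissonProcess P ρ p)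
    {A : Set ℝ≥0} (hA : MeasurableSet A) (c : ℝ≥0∞) :
    ∫⁻ ω, expNeg (c * (occupation (p ω) A : ℝ≥0∞)) ∂P = expNeg (ρ A * (1 - expNeg c)) := by
  by_cases hρ : ρ A = ∞
  · rw [lintegral_congr_ae (g := fun _ => expNeg (c * ∞))
      (by filter_upwards [hp.poisson_top A hA hρ] with ω hω; simp [hω])]
    rcases eq_or_ne c 0 with rfl | hc
    · simp
    · have : 1 - expNeg c ≠ 0 := one_sub_expNeg_eq_zero.not.2 hc
      simp [hρ, ENNReal.mul_top hc, ENNReal.top_mul this]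
  · have hm := hp.measurable_occupation hA
    have law : P.map (fun ω => occupation (p ω) A) =
        (poissonMeasure (ρ A).toNNReal).map (fun n : ℕ => (n : ℕ∞)) := by
      have hmn : Measurable (fun n : ℕ => (n : ℕ∞)) := by fun_prop
      have : IsProbabilityMeasure (P.map (fun ω => occupation (p ω) A)) :=
        Measure.isProbabilityMeasure_map hm.aemeasurable
      have : IsProbabilityMeasure ((poissonMeasure (ρ A).toNNReal).map (fun n : ℕ => (n : ℕ∞))) :=
        Measure.isProbabilityMeasure_map hmn.aemeasurable
      have hj (j : ℕ) : P.map (fun ω => occupation (p ω) A) {(j : ℕ∞)} =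
          (poissonMeasure (ρ A).toNNReal).map (fun n : ℕ => (n : ℕ∞)) {(j : ℕ∞)} := by
        rw [Measure.map_apply hm (measurableSet_singleton _),
          Measure.map_apply hmn (measurableSet_singleton _)]
        convert hp.poisson A hA hρ j using 2 <;> ext n <;> simp
      refine Measure.ext_of_singleton fun a => ?_
      induction a with
      | coe j => exact hj j
      -- The mass at `⊤` is what the naturals leave of total mass 1.
      | top =>
        have e : ({⊤} : Set ℕ∞) = (⋃ j : ℕ, {(j : ℕ∞)})ᶜ := by
          ext a; induction a <;> simp
        have hd : Pairwise (Function.onFun Disjoint fun j : ℕ => ({(j : ℕ∞)} : Set ℕ∞)) := by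
          intro i j hij; simpa [Function.onFun] using hij
        rw [e, prob_compl_eq_one_sub (by measurability), prob_compl_eq_one_sub (by measurability),
          measure_iUnion hd (by measurability), measure_iUnion hd (by measurability)]
        simp_rw [hj]
    calc ∫⁻ ω, expNeg (c * (occupation (p ω) A : ℝ≥0∞)) ∂P
        = ∫⁻ N : ℕ∞, expNeg (c * (N : ℝ≥0∞)) ∂(P.map (fun ω => occupation (p ω) A)) := by
          rw [lintegral_map (by fun_prop) hm]
      _ = ∑' n : ℕ, poissonMeasure (ρ A).toNNReal {n} * expNeg (c * n) := by
          rw [law, lintegral_map (by fun_prop) (by fun_prop), lintegral_countable']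
          simp [mul_comm]
      _ = _ := by rw [tsum_poisson, ENNReal.coe_toNNReal hρ]

/-- The level sets of `s` are disjoint, so the sum over points is a combination of independent
occupation numbers. -/
lemma lintegral_expNeg_simpleFunc [IsProbabilityMeasure P] (hp : IsPoissonProcess P ρ p)
    (s : SimpleFunc ℝ≥0 ℝ≥0∞) :
    ∫⁻ ω, expNeg (∑' n, s (p ω n)) ∂P = expNeg (∫⁻ y, (1 - expNeg (s y)) ∂ρ) := by
  set e := s.range.equivFin.symm with he
  set A : Fin s.range.card → Set ℝ≥0 := fun i => s ⁻¹' {(e i : ℝ≥0∞)} with hA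
  have hAm (i) : MeasurableSet (A i) := s.measurableSet_preimage _
  have hAd (i j) (hij : i ≠ j) : Disjoint (A i) (A j) := by
    refine Disjoint.preimage _ ?_
    simpa [Subtype.ext_iff] using fun h => hij (e.injective (Subtype.ext h))
  have reindex (h : ℝ≥0∞ → ℝ≥0∞) : ∑ c ∈ s.range, h c = ∑ i, h (e i) := by
    rw [← Finset.sum_coe_sort, ← e.sum_comp]
  have h1 (ω : Ω) : ∑' n, s (p ω n) = ∑ i, (e i : ℝ≥0∞) * (occupation (p ω) (A i) : ℝ≥0∞) := by
    rw [← lintegral_countingMeasure _ s.measurable, SimpleFunc.lintegral_eq_lintegral,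
      SimpleFunc.lintegral, reindex fun c => c * countingMeasure (p ω) (s ⁻¹' {c})]
    exact Finset.sum_congr rfl fun i _ => by rw [← countingMeasure_apply _ (hAm i)]
  have h2 : ∫⁻ y, (1 - expNeg (s y)) ∂ρ = ∑ i, ρ (A i) * (1 - expNeg (e i)) := by
    have : ∫⁻ y, (1 - expNeg (s y)) ∂ρ = ∫⁻ y, s.map (fun c => 1 - expNeg c) y ∂ρ := rfl
    rw [this, SimpleFunc.lintegral_eq_lintegral, SimpleFunc.map_lintegral,
      reindex fun c => (1 - expNeg c) * ρ (s ⁻¹' {c})]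
    exact Finset.sum_congr rfl fun i _ => mul_comm _ _
  have hind : iIndepFun (fun i ω => expNeg ((e i : ℝ≥0∞) * (occupation (p ω) (A i) : ℝ≥0∞))) P :=
    (hp.indep _ A hAm hAd).comp (fun i (N : ℕ∞) => expNeg ((e i : ℝ≥0∞) * (N : ℝ≥0∞)))
      fun i => measurable_from_top
  simp_rw [h1, h2, expNeg_sum]
  rw [lintegral_prod_eq_prod_lintegral_of_indepFun _ _ hind]
  · simp_rw [hp.lintegral_expNeg_occupation (hAm _)]
  · intro i
    have := hp.measurable_occupation (hAm i)
    fun_prop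

/-- The Laplace functional of a Poisson process. -/
lemma laplace [IsProbabilityMeasure P] (hp : IsPoissonProcess P ρ p)
    {f : ℝ≥0 → ℝ≥0∞} (hf : Measurable f) :
    ∫⁻ ω, expNeg (∑' n, f (p ω n)) ∂P = expNeg (∫⁻ y, (1 - expNeg (f y)) ∂ρ) := by
  have hmono (y : ℝ≥0) : Monotone fun N => SimpleFunc.eapprox f N y :=
    fun _ _ h => SimpleFunc.monotone_eapprox f h y
  -- For each fixed configuration this is monotone convergence against its counting measure; the
  -- outer expectation is dominated by 1.
  have hL : Filter.Tendsto (fun N => ∫⁻ ω, expNeg (∑' n, SimpleFunc.eapprox f N (p ω n)) ∂P)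
      Filter.atTop (nhds (∫⁻ ω, expNeg (∑' n, f (p ω n)) ∂P)) := by
    refine tendsto_lintegral_of_dominated_convergence (fun _ => 1)
      (fun N => measurable_expNeg.comp (hp.measurable_tsum (SimpleFunc.measurable _)))
      (fun N => ae_of_all _ fun ω => expNeg_le_one _) (by simp) (ae_of_all _ fun ω => ?_)
    refine (continuous_expNeg.tendsto _).comp ?_
    simp_rw [← lintegral_countingMeasure _ (SimpleFunc.measurable _),
      ← lintegral_countingMeasure _ hf]
    exact lintegral_tendsto_of_tendsto_of_monotone
      (fun N => (SimpleFunc.measurable _).aemeasurable) (ae_of_all _ hmono)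
      (ae_of_all _ fun y => SimpleFunc.tendsto_eapprox hf y)
  have hR : Filter.Tendsto (fun N => expNeg (∫⁻ y, (1 - expNeg (SimpleFunc.eapprox f N y)) ∂ρ))
      Filter.atTop (nhds (expNeg (∫⁻ y, (1 - expNeg (f y)) ∂ρ))) := by
    refine (continuous_expNeg.tendsto _).comp ?_
    refine lintegral_tendsto_of_tendsto_of_monotone
      (fun N => by fun_prop)
      (ae_of_all _ fun y a b hab => tsub_le_tsub_left (expNeg_strictAnti.antitone (hmono y hab)) _)
      (ae_of_all _ fun y => ?_)
    exact ENNReal.Tendsto.sub tendsto_const_nhds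
      ((continuous_expNeg.tendsto _).comp (SimpleFunc.tendsto_eapprox hf y)) (by simp)
  simp_rw [hp.lintegral_expNeg_simpleFunc] at hL
  exact tendsto_nhds_unique hL hR

end IsPoissonProcess

/-! ### Independent blocks and marked Poisson processes. -/

/-- Grouping independent variables into disjoint blocks preserves independence. -/
lemma iIndepFun_curry {Ω ι : Type*} [MeasurableSpace Ω] {P : Measure Ω} {κ : ι → Type*}
    {E : Type*} [MeasurableSpace E] {X : (i : ι) → κ i → Ω → E} (hm : ∀ i j, Measurable (X i j))
    (h : iIndepFun (fun (q : Σ i, κ i) ω => X q.1 q.2 ω) P) :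
    iIndepFun (fun i ω (j : κ i) => X i j ω) P := by
  have := h.isProbabilityMeasure
  have h1 (i : ι) (j : κ i) : IsProbabilityMeasure (P.map (X i j)) :=
    Measure.isProbabilityMeasure_map (hm i j).aemeasurable
  have hblock (i : ι) : P.map (fun ω j => X i j ω) = Measure.infinitePi fun j => P.map (X i j) :=
    (h.precomp (g := fun j : κ i => (⟨i, j⟩ : Σ i, κ i))
      sigma_mk_injective).map_fun_eq_infinitePi_map fun j => hm i j
  have hmX : Measurable fun ω (q : Σ i, κ i) => X q.1 q.2 ω :=
    measurable_pi_lambda _ fun q => hm q.1 q.2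
  rw [iIndepFun_iff_map_fun_eq_infinitePi_map (fun i => measurable_pi_lambda _ (hm i))]
  simp_rw [hblock]
  -- Independence means that the joint law is a product, and a product over a sigma type is a
  -- product of products.
  rw [← Measure.infinitePi_map_piCurry,
    ← iIndepFun.map_fun_eq_infinitePi_map (X := fun (q : Σ i, κ i) ω => X q.1 q.2 ω)
      (fun q => hm q.1 q.2) h, Measure.map_map (by fun_prop) hmX]
  rfl

namespace IsPoissonProcess

variable {Ω : Type*} [MeasurableSpace Ω] {P : Measure Ω} {ρ : Measure ℝ≥0} {p : Ω → ℕ → ℝ≥0}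

/-- The Laplace transform of the sum of the points of a Poisson process weighted by independent
identically distributed marks that are independent of the process. -/
lemma laplace_marked [IsProbabilityMeasure P] [SFinite ρ] (hp : IsPoissonProcess P ρ p)
    {W : ℕ → Ω → ℝ≥0∞} (hW : ∀ j, Measurable (W j)) (hi : iIndepFun W P)
    (hpW : IndepFun p (fun ω j => W j ω) P) {ν : Measure ℝ≥0∞} [IsProbabilityMeasure ν]
    (hν : ∀ j, P.map (W j) = ν) (t : ℝ≥0∞) :
    ∫⁻ ω, expNeg (t * ∑' j, p ω j * W j ω) ∂P =
      expNeg (∫⁻ w, ∫⁻ s, (1 - expNeg (s * (t * w))) ∂ρ ∂ν) := by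
  set L : ℝ≥0 → ℝ≥0∞ := fun s => ∫⁻ w, expNeg (s * (t * w)) ∂ν with hL
  have hLm : Measurable L := by
    refine Measurable.lintegral_prod_right' (f := fun q : ℝ≥0 × ℝ≥0∞ => expNeg (q.1 * (t * q.2))) ?_
    fun_prop
  have hL1 (s) : expNeg (negLog (L s)) = L s := expNeg_negLog (lintegral_expNeg_le_one _)
  -- With the points frozen at `q`, averaging the marks gives `∏ L (q j)`. Writing `L` as `exp
  -- (-negLog L)` makes this an additive functional of the points, to which the unmarked formula
  -- applies.
  have inner (q : ℕ → ℝ≥0) :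
      ∫⁻ ω, expNeg (∑' j, q j * (t * W j ω)) ∂P = expNeg (∑' j, negLog (L (q j))) := by
    have h1 : Filter.Tendsto
        (fun N => ∫⁻ ω, ∏ j ∈ Finset.range N, expNeg (q j * (t * W j ω)) ∂P)
        Filter.atTop (nhds (∫⁻ ω, expNeg (∑' j, q j * (t * W j ω)) ∂P)) := by
      refine tendsto_lintegral_of_dominated_convergence (fun _ => 1)
        (fun N => Finset.measurable_fun_prod _ fun j _ => by fun_prop)
        (fun N => ae_of_all _ fun ω => Finset.prod_le_one' fun j _ => expNeg_le_one _)
        (by simp) (ae_of_all _ fun ω => tendsto_prod_expNeg _)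
    have h2 (N : ℕ) : ∫⁻ ω, ∏ j ∈ Finset.range N, expNeg (q j * (t * W j ω)) ∂P =
        ∏ j ∈ Finset.range N, expNeg (negLog (L (q j))) := by
      rw [lintegral_prod_eq_prod_lintegral_of_indepFun _
        (fun j ω => expNeg (q j * (t * W j ω)))
        (hi.comp (fun j w => expNeg (q j * (t * w))) fun j => by fun_prop)
        (fun j => by fun_prop)]
      refine Finset.prod_congr rfl fun j _ => ?_
      rw [hL1, hL, ← hν j]
      exact (lintegral_map (f := fun w => expNeg (q j * (t * w))) (by fun_prop) (hW j)).symm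
    simp_rw [h2] at h1
    exact tendsto_nhds_unique h1 (tendsto_prod_expNeg _)
  have hWm : Measurable fun ω j => W j ω := measurable_pi_lambda _ hW
  have hF : Measurable fun z : (ℕ → ℝ≥0) × (ℕ → ℝ≥0∞) =>
      expNeg (∑' j, z.1 j * (t * z.2 j)) :=
    measurable_expNeg.comp (Measurable.tsum fun j => by fun_prop)
  have hFq (q : ℕ → ℝ≥0) : Measurable fun u : ℕ → ℝ≥0∞ => expNeg (∑' j, q j * (t * u j)) :=
    measurable_expNeg.comp (Measurable.tsum fun j => by fun_prop)
  calc ∫⁻ ω, expNeg (t * ∑' j, p ω j * W j ω) ∂P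
      = ∫⁻ ω, expNeg (∑' j, p ω j * (t * W j ω)) ∂P := by
        simp_rw [← ENNReal.tsum_mul_left, mul_left_comm t]
    _ = ∫⁻ z, expNeg (∑' j, z.1 j * (t * z.2 j)) ∂(P.map fun ω => (p ω, fun j => W j ω)) := by
        rw [lintegral_map hF (hp.measurable.prodMk hWm)]
    _ = ∫⁻ q, ∫⁻ u, expNeg (∑' j, q j * (t * u j)) ∂(P.map fun ω j => W j ω) ∂(P.map p) := by
        have : IsProbabilityMeasure (P.map fun ω j => W j ω) :=
          Measure.isProbabilityMeasure_map hWm.aemeasurable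
        rw [(indepFun_iff_map_prod_eq_prod_map_map hp.measurable.aemeasurable
          hWm.aemeasurable).1 hpW, lintegral_prod _ hF.aemeasurable]
    _ = ∫⁻ q, expNeg (∑' j, negLog (L (q j))) ∂(P.map p) := by
        refine lintegral_congr fun q => ?_
        rw [← inner]
        exact lintegral_map (hFq q) hWm
    _ = ∫⁻ ω, expNeg (∑' j, negLog (L (p ω j))) ∂P := by
        rw [lintegral_map _ hp.measurable]
        exact measurable_expNeg.comp (Measurable.tsum fun j => by fun_prop)
    _ = expNeg (∫⁻ s, (1 - L s) ∂ρ) := by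
        rw [hp.laplace (f := fun s => negLog (L s)) (by fun_prop)]
        simp_rw [hL1]
    _ = _ := by
        rw [lintegral_lintegral_swap
          (f := fun w (s : ℝ≥0) => 1 - expNeg (s * (t * w))) (by fun_prop)]
        simp_rw [hL]
        congr 1
        refine lintegral_congr fun s => ?_
        rw [lintegral_one_sub_expNeg (by fun_prop)]

end IsPoissonProcess

/-! ### Scaling and integrability for the REM intensity. -/

instance (x : ℝ) : SFinite (remIntensity x) := by unfold remIntensity; infer_instance

lemma lintegral_remIntensity (x : ℝ) {f : ℝ≥0 → ℝ≥0∞} (hf : Measurable f) :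
    ∫⁻ s, f s ∂(remIntensity x) =
      ∫⁻ t in Set.Ioi (0 : ℝ), ENNReal.ofReal (x * t ^ (-x - 1)) * f t.toNNReal := by
  rw [remIntensity, lintegral_map hf (by fun_prop),
    lintegral_withDensity_eq_lintegral_mul _ (by fun_prop) (by fun_prop)]
  rfl

/-- Substitute `t ↦ t * w` in the density `x t ^ (-x - 1)`. -/
lemma lintegral_remIntensity_scale (x : ℝ) {f : ℝ≥0 → ℝ≥0∞} (hf : Measurable f)
    {w : ℝ≥0} (hw : w ≠ 0) :
    ∫⁻ s, f (s * w) ∂(remIntensity x) = (w : ℝ≥0∞) ^ x * ∫⁻ s, f s ∂(remIntensity x) := by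
  have hw0 : (0 : ℝ) < w := by positivity
  rw [lintegral_remIntensity x (f := fun s => f (s * w)) (by fun_prop),
    lintegral_remIntensity x hf]
  have himg : (fun t : ℝ => t * w) '' Set.Ioi 0 = Set.Ioi 0 := by
    ext t
    refine ⟨?_, fun ht => ⟨t / w, div_pos ht hw0, div_mul_cancel₀ _ hw0.ne'⟩⟩
    rintro ⟨s, hs, rfl⟩
    exact mul_pos hs hw0
  conv_rhs => rw [← himg]
  rw [lintegral_image_eq_lintegral_abs_deriv_mul measurableSet_Ioi
    (f' := fun _ => (w : ℝ))
    (fun t _ => by simpa using ((hasDerivAt_id t).mul_const (w : ℝ)).hasDerivWithinAt)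
    (fun a _ b _ h => by simpa [hw] using h),
    ← lintegral_const_mul _ (by fun_prop)]
  refine setLIntegral_congr_fun measurableSet_Ioi fun t (ht : 0 < t) => ?_
  have e : (t * (w : ℝ)).toNNReal = t.toNNReal * w := by
    rw [Real.toNNReal_mul ht.le, Real.toNNReal_coe]
  simp only [e]
  rw [← mul_assoc, ← mul_assoc]
  congr 1
  rw [← ENNReal.ofReal_coe_nnreal (p := w), ENNReal.ofReal_rpow_of_pos hw0,
    ← ENNReal.ofReal_mul (by positivity), ← ENNReal.ofReal_mul (by positivity), abs_of_pos hw0]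
  congr 1
  rw [Real.mul_rpow ht.le hw0.le]
  have : (w : ℝ) ^ x * w * (w : ℝ) ^ (-x - 1) = 1 := by
    rw [← Real.rpow_add_one hw0.ne', ← Real.rpow_add hw0]
    simp
  linear_combination (-(x * t ^ (-x - 1))) * this

/-- The constant `c` in the Laplace transform `t ↦ exp (-c t ^ x)` of a REM partition function. -/
noncomputable def remConst (x : ℝ) : ℝ≥0∞ := ∫⁻ s, (1 - expNeg s) ∂(remIntensity x)

lemma remConst_ne_zero {x : ℝ} (hx : 0 < x) : remConst x ≠ 0 := by
  rw [remConst, lintegral_remIntensity x (by fun_prop), ← pos_iff_ne_zero]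
  rw [setLIntegral_pos_iff (by fun_prop)]
  have : Function.support (fun t : ℝ => ENNReal.ofReal (x * t ^ (-x - 1)) *
      (1 - expNeg t.toNNReal)) ∩ Set.Ioi 0 = Set.Ioi 0 := by
    refine Set.inter_eq_right.2 fun t (ht : 0 < t) => ?_
    refine mul_ne_zero ?_ (one_sub_expNeg_eq_zero.not.2 ?_)
    · simpa using by positivity
    · simpa using ht
  rw [this]
  simp

/-- Near 0 the integrand is at most a multiple of `t ^ (a - y - 1)`, integrable since `y < a`;
beyond 1 the density itself is integrable. -/
lemma lintegral_remIntensity_ne_top {y a : ℝ} (hy : 0 < y) (hya : y < a) {K : ℝ≥0∞} (hK : K ≠ ∞)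
    {f : ℝ≥0 → ℝ≥0∞} (hf : Measurable f) (hf1 : ∀ s, f s ≤ 1)
    (hfK : ∀ s : ℝ≥0, f s ≤ K * (s : ℝ≥0∞) ^ a) :
    ∫⁻ s, f s ∂(remIntensity y) ≠ ∞ := by
  rw [lintegral_remIntensity y hf, ← Set.Ioc_union_Ioi_eq_Ioi zero_le_one]
  refine ((lintegral_union_le _ _ _).trans_lt (ENNReal.add_lt_top.2 ⟨?_, ?_⟩)).ne
  · have hint : IntegrableOn (fun t : ℝ => y * t ^ (a - y - 1)) (Set.Ioc 0 1) :=
      ((intervalIntegrable_iff_integrableOn_Ioc_of_le zero_le_one).1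
        (intervalIntegral.intervalIntegrable_rpow' (by linarith))).const_mul y
    refine lt_of_le_of_lt (b := ∫⁻ t in Set.Ioc (0 : ℝ) 1,
      K * ENNReal.ofReal (y * t ^ (a - y - 1))) ?_ ?_
    · refine setLIntegral_mono' measurableSet_Ioc fun t ht => ?_
      have ht0 : 0 < t := ht.1
      refine (mul_le_mul_right (hfK _) _).trans_eq ?_
      rw [show ((t.toNNReal : ℝ≥0) : ℝ≥0∞) = ENNReal.ofReal t from rfl,
        ENNReal.ofReal_rpow_of_pos ht0, mul_left_comm, ← ENNReal.ofReal_mul (by positivity),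
        mul_assoc, ← Real.rpow_add ht0]
      ring_nf
    · rw [lintegral_const_mul' _ _ hK]
      exact ENNReal.mul_lt_top hK.lt_top hint.lintegral_lt_top
  · have hint : IntegrableOn (fun t : ℝ => y * t ^ (-y - 1)) (Set.Ioi 1) :=
      (integrableOn_Ioi_rpow_of_lt (by linarith) one_pos).const_mul y
    refine lt_of_le_of_lt (setLIntegral_mono' measurableSet_Ioi fun t _ => ?_)
      hint.lintegral_lt_top
    exact (mul_le_mul_right (hf1 _) _).trans_eq (mul_one _)

lemma remConst_ne_top {x : ℝ} (hx : 0 < x) (hx1 : x < 1) : remConst x ≠ ∞ :=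
  lintegral_remIntensity_ne_top hx hx1 (K := 1) (by simp) (by fun_prop) (fun _ => tsub_le_self)
    fun s => by simpa using one_sub_expNeg_le s

lemma lintegral_remIntensity_one_sub_expNeg {x : ℝ} (hx : 0 < x) (w : ℝ≥0∞) :
    ∫⁻ s, (1 - expNeg (s * w)) ∂(remIntensity x) = w ^ x * remConst x := by
  have hcoe (w : ℝ≥0) :
      ∫⁻ s, (1 - expNeg (s * w)) ∂(remIntensity x) = (w : ℝ≥0∞) ^ x * remConst x := by
    rcases eq_or_ne w 0 with rfl | hw
    · simp [hx]
    · rw [remConst, ← lintegral_remIntensity_scale x (by fun_prop) hw]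
      simp
  induction w with
  | coe w => exact hcoe w
  | top =>
    rw [ENNReal.top_rpow_of_pos hx, ENNReal.top_mul (remConst_ne_zero hx)]
    -- Dilation by `∞` is not covered by scaling; the value is bounded below by those at finite `n`,
    -- which tend to `∞`.
    have hle (n : ℕ) : ((n : ℝ≥0) : ℝ≥0∞) ^ x * remConst x ≤
        ∫⁻ s, (1 - expNeg (s * ∞)) ∂(remIntensity x) := by
      rw [← hcoe]
      exact lintegral_mono fun s => tsub_le_tsub_left
        (expNeg_strictAnti.antitone (mul_le_mul_right le_top _)) _
    refine top_le_iff.1 (le_of_tendsto' (x := Filter.atTop)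
      (f := fun n : ℕ => ((n : ℝ≥0) : ℝ≥0∞) ^ x * remConst x) ?_ hle)
    have h1 : Filter.Tendsto (fun n : ℕ => (((n : ℝ≥0) : ℝ≥0∞)) ^ x) Filter.atTop (nhds ∞) := by
      have := ((ENNReal.continuous_rpow_const (y := x)).tendsto ∞).comp
        ENNReal.tendsto_nat_nhds_top
      rw [ENNReal.top_rpow_of_pos hx] at this
      simpa [Function.comp_def] using this
    have := ENNReal.Tendsto.mul_const h1 (Or.inl ENNReal.top_ne_zero) (b := remConst x)
    rwa [ENNReal.top_mul (remConst_ne_zero hx)] at this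

/-! ### Laplace transforms of REM partition functions. -/

namespace IsREM

variable {Ω : Type*} [MeasurableSpace Ω] {P : Measure Ω} {x : ℝ} {p : Ω → ℕ → ℝ≥0}

lemma measurable_remPartition (hp : IsREM P x p) : Measurable fun ω => remPartition (p ω) :=
  IsPoissonProcess.measurable_tsum hp (f := fun s => s) (by fun_prop)

lemma laplace [IsProbabilityMeasure P] (hx : 0 < x) (hp : IsREM P x p) (t : ℝ≥0∞) :
    ∫⁻ ω, expNeg (t * remPartition (p ω)) ∂P = expNeg (t ^ x * remConst x) := by
  simp_rw [remPartition, ← ENNReal.tsum_mul_left, mul_comm t]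
  rw [IsPoissonProcess.laplace hp (f := fun s => s * t) (by fun_prop),
    lintegral_remIntensity_one_sub_expNeg hx]

/-- The marks enter only through `E[W ^ x]`, which may be infinite: they amount to a deterministic
rescaling. -/
lemma laplace_marked [IsProbabilityMeasure P] (hx : 0 < x) (hp : IsREM P x p)
    {W : ℕ → Ω → ℝ≥0∞} (hW : ∀ j, Measurable (W j)) (hi : iIndepFun W P)
    (hpW : IndepFun p (fun ω j => W j ω) P) {ν : Measure ℝ≥0∞} [IsProbabilityMeasure ν]
    (hν : ∀ j, P.map (W j) = ν) (t : ℝ≥0∞) :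
    ∫⁻ ω, expNeg (t * ∑' j, p ω j * W j ω) ∂P =
      expNeg (t ^ x * (∫⁻ w, w ^ x ∂ν) * remConst x) := by
  rw [IsPoissonProcess.laplace_marked hp hW hi hpW hν t]
  simp_rw [lintegral_remIntensity_one_sub_expNeg hx, ENNReal.mul_rpow_of_nonneg _ _ hx.le]
  rw [lintegral_mul_const _ (by fun_prop), lintegral_const_mul _ (by fun_prop)]

end IsREM

/-! ### Recursive structure of the cascade. -/

section Cascade

/-- The cascade hanging below the point with label `j` of the first level. -/
def subcascade {Ω : Type*} {k : ℕ} (ξ : (n : Fin (k + 1)) → (Fin n → ℕ) → Ω → ℕ → ℝ≥0) (j : ℕ) :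
    (n : Fin k) → (Fin n → ℕ) → Ω → ℕ → ℝ≥0 :=
  fun n a => ξ n.succ (Fin.cons (α := fun _ => ℕ) j a)

lemma cascadePoint_cons {Ω : Type*} {k : ℕ} (ξ : (n : Fin (k + 1)) → (Fin n → ℕ) → Ω → ℕ → ℝ≥0)
    (ω : Ω) (j : ℕ) (β : Fin k → ℕ) :
    cascadePoint ξ ω (Fin.cons (α := fun _ => ℕ) j β) =
      ξ 0 Fin.elim0 ω j * cascadePoint (subcascade ξ j) ω β := by
  rw [cascadePoint, Fin.prod_univ_succ]
  congr 1
  · rw [Fin.cons_zero]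
    congr
    ext i; exact i.elim0
  · refine Finset.prod_congr rfl fun n _ => ?_
    rw [Fin.cons_succ, subcascade]
    congr 2
    ext i
    refine Fin.cases ?_ (fun i => ?_) i <;> rfl

lemma cascadePartition_succ {Ω : Type*} {k : ℕ} (ξ : (n : Fin (k + 1)) → (Fin n → ℕ) → Ω → ℕ → ℝ≥0)
    (ω : Ω) :
    cascadePartition ξ ω =
      ∑' j, (ξ 0 Fin.elim0 ω j : ℝ≥0∞) * cascadePartition (subcascade ξ j) ω := by
  rw [cascadePartition, ← (Fin.consEquiv fun _ : Fin (k + 1) => ℕ).tsum_eq, ENNReal.tsum_prod']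
  refine tsum_congr fun j => ?_
  rw [cascadePartition, ← ENNReal.tsum_mul_left]
  refine tsum_congr fun β => ?_
  rw [← ENNReal.coe_mul, ← cascadePoint_cons]
  rfl

variable {Ω : Type*} [MeasurableSpace Ω] {P : Measure Ω}

lemma measurable_cascadePartition {k : ℕ} {ξ : (n : Fin k) → (Fin n → ℕ) → Ω → ℕ → ℝ≥0}
    (h : ∀ n a, Measurable (ξ n a)) : Measurable (cascadePartition ξ) := by
  unfold cascadePartition cascadePoint
  refine Measurable.tsum fun α => ?_
  have hm (n : Fin k) : Measurable fun ω => ξ n (fun i => α (Fin.castLE n.isLt.le i)) ω (α n) :=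
    (measurable_pi_apply _).comp (h _ _)
  fun_prop

/-- The address in the full cascade of an address below a point of the first level. -/
def subcascadeAddress {k : ℕ} (q : Σ _ : ℕ, Σ n : Fin k, (Fin n → ℕ)) :
    Σ n : Fin (k + 1), (Fin n → ℕ) :=
  ⟨q.2.1.succ, Fin.cons (α := fun _ => ℕ) q.1 q.2.2⟩

lemma subcascadeAddress_injective (k : ℕ) : Function.Injective (subcascadeAddress (k := k)) := by
  rintro ⟨i, n, a⟩ ⟨j, m, b⟩ h
  simp only [subcascadeAddress, Sigma.mk.injEq, Fin.succ_inj] at h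
  obtain ⟨rfl, h⟩ := h
  have h := eq_of_heq h
  obtain ⟨rfl, rfl⟩ := Fin.cons_injective2 (α := fun _ => ℕ) h
  rfl

namespace IsCascade

variable {k : ℕ} {x : ℕ → ℝ}

lemma subcascade {ξ : (n : Fin (k + 1)) → (Fin n → ℕ) → Ω → ℕ → ℝ≥0}
    (h : IsCascade P (k + 1) x ξ) (j : ℕ) :
    IsCascade P k (fun n => x (n + 1)) (subcascade ξ j) where
  isREM n a := h.isREM n.succ (Fin.cons (α := fun _ => ℕ) j a)
  indep := h.indep.precomp (g := fun q => subcascadeAddress ⟨j, q⟩)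
    ((subcascadeAddress_injective k).comp sigma_mk_injective)

lemma measurable {ξ : (n : Fin k) → (Fin n → ℕ) → Ω → ℕ → ℝ≥0} (h : IsCascade P k x ξ) :
    Measurable (cascadePartition ξ) :=
  measurable_cascadePartition fun n a => (h.isREM n a).measurable

variable {ξ : (n : Fin (k + 1)) → (Fin n → ℕ) → Ω → ℕ → ℝ≥0}

/-- The partition function of a cascade as a function of all its points. -/
noncomputable def partitionOfPoints (k : ℕ) (u : (Σ n : Fin k, (Fin n → ℕ)) → ℕ → ℝ≥0) : ℝ≥0∞ :=
  cascadePartition (fun n a (v : (Σ n : Fin k, (Fin n → ℕ)) → ℕ → ℝ≥0) => v ⟨n, a⟩) u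

lemma measurable_partitionOfPoints (k : ℕ) : Measurable (partitionOfPoints k) :=
  measurable_cascadePartition (ξ := fun n a (v : (Σ n : Fin k, (Fin n → ℕ)) → ℕ → ℝ≥0) => v ⟨n, a⟩)
    fun n a => by fun_prop

/-- Cascades below distinct first-level points use disjoint sets of addresses. -/
lemma iIndepFun_subcascade (h : IsCascade P (k + 1) x ξ) :
    iIndepFun (fun j => cascadePartition (_root_.subcascade ξ j)) P :=
  (iIndepFun_curry (X := fun (j : ℕ) (q : Σ n : Fin k, (Fin n → ℕ)) =>
      _root_.subcascade ξ j q.1 q.2) (fun _ q => (h.isREM q.1.succ _).measurable)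
    (h.indep.precomp (subcascadeAddress_injective k))).comp
    (fun _ => partitionOfPoints k) fun _ => measurable_partitionOfPoints k

lemma indepFun_subcascade (h : IsCascade P (k + 1) x ξ) :
    IndepFun (ξ 0 Fin.elim0) (fun ω j => cascadePartition (_root_.subcascade ξ j) ω) P := by
  -- Two blocks of addresses: `false` is the first-level process, `true` everything below it.
  let κ : Bool → Type := fun b => bif b then (Σ _ : ℕ, Σ n : Fin k, (Fin n → ℕ)) else Unit
  let g : (b : Bool) → κ b → Σ n : Fin (k + 1), (Fin n → ℕ) := fun b => match b with
    | true => subcascadeAddress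
    | false => fun _ => ⟨0, Fin.elim0⟩
  have hg : Function.Injective fun q : Σ b, κ b => g q.1 q.2 := by
    rintro ⟨_ | _, a⟩ ⟨_ | _, b⟩ hab
    · rfl
    · exact absurd (congrArg Sigma.fst hab) (Fin.succ_ne_zero _).symm
    · exact absurd (congrArg Sigma.fst hab) (Fin.succ_ne_zero _)
    · exact congrArg (Sigma.mk true) (subcascadeAddress_injective k hab)
  have := (iIndepFun_curry (X := fun b (q : κ b) => ξ (g b q).1 (g b q).2)
    (fun b q => (h.isREM _ _).measurable) (h.indep.precomp hg)).indepFun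
    (i := false) (j := true) (by simp)
  exact this.comp (φ := fun u : Unit → ℕ → ℝ≥0 => u ())
    (ψ := fun (u : (Σ _ : ℕ, Σ n : Fin k, (Fin n → ℕ)) → ℕ → ℝ≥0) j =>
      partitionOfPoints k fun q => u ⟨j, q⟩) (by fun_prop)
    (measurable_pi_lambda _ fun j => (measurable_partitionOfPoints k).comp (by fun_prop))

end IsCascade

/-! ### The law of the cascade partition function. -/

/-- The random variable `Z_{x 1} * ∏ n = 2..k, E[Z_{x n} ^ x (n - 1)] ^ (1 / x (n - 1))`,
or `1` if `k = 0`. -/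
noncomputable def remProduct (P : Measure Ω) (k : ℕ) (x : ℕ → ℝ) (η : ℕ → Ω → ℕ → ℝ≥0)
    (ω : Ω) : ℝ≥0∞ :=
  if k = 0 then 1 else remPartition (η 1 ω) * ∏ n ∈ Finset.Icc 2 k,
    (∫⁻ ω', remPartition (η n ω') ^ x (n - 1) ∂P) ^ (1 / x (n - 1))

lemma measurable_remProduct {k : ℕ} {x : ℕ → ℝ} {η : ℕ → Ω → ℕ → ℝ≥0}
    (hη : ∀ n ∈ Finset.Icc 1 k, IsREM P (x n) (η n)) : Measurable (remProduct P k x η) := by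
  unfold remProduct
  split_ifs with hk
  · fun_prop
  · exact (hη 1 (by simp; omega)).measurable_remPartition.mul_const _

/-- This is the moment `E[W ^ x_1]` of the marks. The random factor `Z_{x_2}` contributes `E[Z_{x_2}
^ x_1]`, the new factor at `n = 2`; the others only shift their index. -/
lemma lintegral_remProduct_rpow [IsProbabilityMeasure P] {k : ℕ} {x : ℕ → ℝ}
    {η : ℕ → Ω → ℕ → ℝ≥0} (hx : 0 < x 1) (hη : ∀ n ∈ Finset.Icc 1 (k + 1), IsREM P (x n) (η n)) :
    ∫⁻ ω, remProduct P k (fun n => x (n + 1)) (fun n => η (n + 1)) ω ^ x 1 ∂P =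
      (∏ n ∈ Finset.Icc 2 (k + 1),
        (∫⁻ ω', remPartition (η n ω') ^ x (n - 1) ∂P) ^ (1 / x (n - 1))) ^ x 1 := by
  rcases k with _ | k
  · simp [remProduct]
  · have hm := (hη 2 (by simp)).measurable_remPartition
    simp only [remProduct, Nat.add_eq_zero_iff, one_ne_zero, and_false, if_false,
      ENNReal.mul_rpow_of_nonneg _ _ hx.le]
    rw [lintegral_mul_const _ (by fun_prop),
      ← Finset.insert_Icc_add_one_left_eq_Icc (by omega : 2 ≤ k + 1 + 1),
      Finset.prod_insert (by simp), ENNReal.mul_rpow_of_nonneg _ _ hx.le, ← ENNReal.rpow_mul]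
    simp only [one_div, inv_mul_cancel₀ hx.ne', ENNReal.rpow_one,
      show 2 - 1 = 1 from rfl, one_add_one_eq_two]
    congr 2
    rw [← Finset.image_add_right_Icc, Finset.prod_image (by simp)]
    refine Finset.prod_congr rfl fun n hn => ?_
    have : n - 1 + 1 = n := by simp at hn; omega
    simp [this]

/-- Induction on the number of levels, peeling off the first. It starts at `k = 0`, where the empty
address gives the constant 1. -/
lemma IsCascade.map_cascadePartition [IsProbabilityMeasure P] {Ω' : Type*} [MeasurableSpace Ω']
    {P' : Measure Ω'} [IsProbabilityMeasure P'] {k : ℕ} {x : ℕ → ℝ}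
    (hx : ∀ n ∈ Finset.Icc 1 k, 0 < x n)
    {ξ : (n : Fin k) → (Fin n → ℕ) → Ω → ℕ → ℝ≥0} (hξ : IsCascade P k x ξ)
    {η : ℕ → Ω' → ℕ → ℝ≥0} (hη : ∀ n ∈ Finset.Icc 1 k, IsREM P' (x n) (η n)) :
    P.map (cascadePartition ξ) = P'.map (remProduct P' k x η) := by
  induction k generalizing x η with
  | zero =>
    have h1 : cascadePartition ξ = fun _ => 1 := by
      ext ω; simp [cascadePartition, cascadePoint]
    have h2 : remProduct P' 0 x η = fun _ => 1 := by ext ω; simp [remProduct]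
    simp [h1, h2]
  | succ k ih =>
    have hx1 : 0 < x 1 := hx 1 (by simp)
    have hη' : ∀ n ∈ Finset.Icc 1 k, IsREM P' (x (n + 1)) (η (n + 1)) := fun n hn =>
      hη (n + 1) (by simp at hn ⊢; omega)
    have hsub (j : ℕ) := ih (fun n hn => hx (n + 1) (by simp at hn ⊢; omega)) (hξ.subcascade j) hη'
    have hm := measurable_remProduct hη'
    have hM := measurable_remProduct hη
    have := Measure.isProbabilityMeasure_map hm.aemeasurable (μ := P')
    have := Measure.isProbabilityMeasure_map hM.aemeasurable (μ := P')
    have := Measure.isProbabilityMeasure_map hξ.measurable.aemeasurable (μ := P)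
    refine Measure.ext_of_laplace fun t => ?_
    rw [lintegral_map (by fun_prop) hξ.measurable, lintegral_map (by fun_prop) hM]
    simp_rw [cascadePartition_succ]
    -- With `M` the constant product, the exponent becomes `(t * M) ^ x 1 * remConst (x 1)`, which
    -- is the transform of `Z_{x_1}` at `t * M`.
    rw [IsREM.laplace_marked hx1 (hξ.isREM 0 Fin.elim0) (fun j => (hξ.subcascade j).measurable)
      hξ.iIndepFun_subcascade hξ.indepFun_subcascade hsub, lintegral_map (by fun_prop) hm,
      lintegral_remProduct_rpow hx1 hη, ← ENNReal.mul_rpow_of_nonneg _ _ hx1.le,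
      ← IsREM.laplace hx1 (hη 1 (by simp))]
    simp only [remProduct, Nat.add_eq_zero_iff, one_ne_zero, and_false, if_false]
    simp_rw [mul_assoc, mul_comm (remPartition _)]

end Cascade

/-! ### Moments, positivity and finiteness, integrability of the logarithm. -/

/-- Expresses a fractional moment through the Laplace transform, by averaging the scaling identity
over `Z` and exchanging integrals. -/
lemma lintegral_rpow_mul_remConst {Ω : Type*} [MeasurableSpace Ω] {P : Measure Ω} [SFinite P]
    {y : ℝ} (hy : 0 < y) {Z : Ω → ℝ≥0∞} (hZ : Measurable Z) :
    (∫⁻ ω, Z ω ^ y ∂P) * remConst y =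
      ∫⁻ s, ∫⁻ ω, (1 - expNeg (s * Z ω)) ∂P ∂(remIntensity y) := by
  rw [← lintegral_mul_const _ (by fun_prop)]
  simp_rw [← lintegral_remIntensity_one_sub_expNeg hy]
  rw [lintegral_lintegral_swap (f := fun ω (s : ℝ≥0) => 1 - expNeg (s * Z ω)) (by fun_prop)]

/-- Average `1 / z = ∫ e^{-tz} dt` over `Z`. -/
lemma lintegral_inv_eq_lintegral_expNeg {Ω : Type*} [MeasurableSpace Ω] {P : Measure Ω} [SFinite P]
    {Z : Ω → ℝ≥0∞} (hZ : Measurable Z) (h0 : ∀ᵐ ω ∂P, 0 < Z ω) (htop : ∀ᵐ ω ∂P, Z ω < ∞) :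
    ∫⁻ ω, (Z ω)⁻¹ ∂P =
      ∫⁻ t in Set.Ioi (0 : ℝ), ∫⁻ ω, expNeg (ENNReal.ofReal t * Z ω) ∂P := by
  have h1 : ∀ᵐ ω ∂P, (Z ω)⁻¹ =
      ∫⁻ t in Set.Ioi (0 : ℝ), expNeg (ENNReal.ofReal t * Z ω) := by
    filter_upwards [h0, htop] with ω h0 h1
    have hz := ENNReal.toReal_pos h0.ne' h1.ne
    rw [← ENNReal.ofReal_toReal h1.ne]
    set z := (Z ω).toReal
    have hint := integrableOn_exp_mul_Ioi (a := -z) (by linarith) 0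
    have e : ∫⁻ t in Set.Ioi (0 : ℝ), expNeg (ENNReal.ofReal t * ENNReal.ofReal z) =
        ∫⁻ t in Set.Ioi (0 : ℝ), ENNReal.ofReal (Real.exp (-z * t)) := by
      refine setLIntegral_congr_fun measurableSet_Ioi fun t (ht : 0 < t) => ?_
      rw [← ENNReal.ofReal_mul ht.le, expNeg_ofReal (by positivity), neg_mul, mul_comm]
    rw [e, ← ofReal_integral_eq_lintegral_ofReal hint (ae_of_all _ fun t => (Real.exp_pos _).le),
      integral_exp_mul_Ioi (by linarith), ← ENNReal.ofReal_inv_of_pos hz]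
    congr 1
    field_simp
    simp
  rw [lintegral_congr_ae h1, lintegral_lintegral_swap
    (f := fun ω t => expNeg (ENNReal.ofReal t * Z ω)) (by fun_prop)]

namespace IsREM

variable {Ω : Type*} [MeasurableSpace Ω] {P : Measure Ω} [IsProbabilityMeasure P] {x : ℝ}
  {p : Ω → ℕ → ℝ≥0}

lemma ae_remPartition_pos (hx : 0 < x) (hp : IsREM P x p) : ∀ᵐ ω ∂P, 0 < remPartition (p ω) := by
  -- At `t = ∞` the Laplace transform is the probability that the sum vanishes.
  have h := hp.laplace hx ∞
  rw [ENNReal.top_rpow_of_pos hx, ENNReal.top_mul (remConst_ne_zero hx), expNeg_top,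
    lintegral_eq_zero_iff (by have := hp.measurable_remPartition; fun_prop)] at h
  filter_upwards [h] with ω hω
  refine pos_iff_ne_zero.2 fun h0 => ?_
  simp [h0] at hω

/-- Fractional moments of order less than the parameter of a REM are finite. -/
lemma lintegral_remPartition_rpow_ne_top {y : ℝ} (hy : 0 < y) (hyx : y < x) (hx1 : x < 1)
    (hp : IsREM P x p) : ∫⁻ ω, remPartition (p ω) ^ y ∂P ≠ ∞ := by
  have hx : 0 < x := hy.trans hyx
  have hm := hp.measurable_remPartition
  have h : (∫⁻ ω, remPartition (p ω) ^ y ∂P) * remConst y =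
      ∫⁻ s, (1 - expNeg ((s : ℝ≥0∞) ^ x * remConst x)) ∂(remIntensity y) := by
    rw [lintegral_rpow_mul_remConst hy hm]
    refine lintegral_congr fun s => ?_
    rw [lintegral_one_sub_expNeg (by fun_prop), hp.laplace hx]
  have hfin := lintegral_remIntensity_ne_top hy hyx (remConst_ne_top hx hx1)
    (f := fun s => 1 - expNeg ((s : ℝ≥0∞) ^ x * remConst x)) (by fun_prop)
    (fun _ => tsub_le_self) fun s => (one_sub_expNeg_le _).trans_eq (mul_comm _ _)
  rw [← h] at hfin
  intro htop
  rw [htop, ENNReal.top_mul (remConst_ne_zero hy)] at hfin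
  exact hfin rfl

lemma lintegral_remPartition_rpow_ne_zero {y : ℝ} (hy : 0 < y) (hx : 0 < x)
    (hp : IsREM P x p) : ∫⁻ ω, remPartition (p ω) ^ y ∂P ≠ 0 := by
  have hm := hp.measurable_remPartition
  intro h
  rw [lintegral_eq_zero_iff (by fun_prop)] at h
  obtain ⟨ω, h1, h2⟩ := (h.and (hp.ae_remPartition_pos hx)).exists
  exact h2.ne' ((ENNReal.rpow_eq_zero_iff_of_pos hy).1 h1)

lemma ae_remPartition_lt_top (hx : 0 < x) (hx1 : x < 1) (hp : IsREM P x p) :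
    ∀ᵐ ω ∂P, remPartition (p ω) < ∞ := by
  have hm := hp.measurable_remPartition
  filter_upwards [ae_lt_top (by fun_prop)
    (hp.lintegral_remPartition_rpow_ne_top (half_pos hx) (half_lt_self hx) hx1)] with ω hω
  refine lt_top_iff_ne_top.2 fun h => ?_
  rw [h, ENNReal.top_rpow_of_pos (half_pos hx)] at hω
  exact lt_irrefl _ hω

lemma lintegral_inv_remPartition_ne_top (hx : 0 < x) (hx1 : x < 1) (hp : IsREM P x p) :
    ∫⁻ ω, (remPartition (p ω))⁻¹ ∂P ≠ ∞ := by
  have hm := hp.measurable_remPartition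
  rw [lintegral_inv_eq_lintegral_expNeg hm (hp.ae_remPartition_pos hx)
    (hp.ae_remPartition_lt_top hx hx1)]
  simp_rw [hp.laplace hx]
  obtain ⟨c, hc⟩ : ∃ c : ℝ≥0, (c : ℝ≥0∞) = remConst x :=
    ⟨_, ENNReal.coe_toNNReal (remConst_ne_top hx hx1)⟩
  have hc0 : (0 : ℝ) < c := by
    have := remConst_ne_zero hx
    rw [← hc] at this
    exact NNReal.coe_pos.2 (pos_iff_ne_zero.2 (by simpa using this))
  have hint := integrableOn_rpow_mul_exp_neg_mul_rpow (s := 0) (by norm_num) hx hc0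
  refine (lt_of_le_of_lt (setLIntegral_mono' measurableSet_Ioi fun t (ht : 0 < t) => ?_)
    hint.lintegral_lt_top).ne
  rw [← hc, ENNReal.ofReal_rpow_of_pos ht, ← ENNReal.ofReal_coe_nnreal (p := c),
    ← ENNReal.ofReal_mul (by positivity), expNeg_ofReal (by positivity)]
  refine ENNReal.ofReal_le_ofReal ?_
  rw [Real.rpow_zero, one_mul]
  exact (congrArg Real.exp (by ring)).le

/-- Both tails are controlled by `-1/z ≤ log z ≤ z ^ (x/2) / (x/2)`. -/
lemma integrable_log_remPartition (hx : 0 < x) (hx1 : x < 1) (hp : IsREM P x p) :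
    Integrable (fun ω => Real.log (remPartition (p ω)).toReal) P := by
  have hm := hp.measurable_remPartition
  have hy := half_pos hx
  have hmom := hp.lintegral_remPartition_rpow_ne_top hy (half_lt_self hx) hx1
  have hinv := hp.lintegral_inv_remPartition_ne_top hx hx1
  have i1 := integrable_toReal_of_lintegral_ne_top (hm.pow_const _).aemeasurable hmom
  have i2 := integrable_toReal_of_lintegral_ne_top hm.inv.aemeasurable hinv
  refine ((i1.div_const (x / 2)).add i2).mono'
    (Real.measurable_log.comp hm.ennreal_toReal).aestronglyMeasurable ?_
  filter_upwards [hp.ae_remPartition_pos hx, hp.ae_remPartition_lt_top hx hx1] with ω h0 h1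
  have hz := ENNReal.toReal_pos h0.ne' h1.ne
  simp only [Pi.add_apply, Pi.inv_apply, ← ENNReal.toReal_rpow, ENNReal.toReal_inv]
  set z := (remPartition (p ω)).toReal
  rw [Real.norm_eq_abs, abs_le]
  have a1 := Real.log_le_rpow_div hz.le hy
  have a2 : -Real.log z ≤ z⁻¹ := by
    rw [← Real.log_inv]; exact Real.log_le_self (by positivity)
  have a3 : 0 ≤ z ^ (x / 2) / (x / 2) := by positivity
  have a4 : 0 ≤ z⁻¹ := by positivity
  constructor <;> linarith

end IsREM

/-! ### Transfer from the REM product to the cascade. -/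

theorem theorem4p3 {Ω Ω' : Type*} [MeasurableSpace Ω] [MeasurableSpace Ω']
    (P : Measure Ω) [IsProbabilityMeasure P] (P' : Measure Ω') [IsProbabilityMeasure P']
    (k : ℕ) (hk : 2 ≤ k) (x : ℕ → ℝ) (hx_pos : 0 < x 1)
    (hx_mono : StrictMonoOn x (Set.Icc 1 k)) (hx_lt : x k < 1)
    (ξ : (n : Fin k) → (Fin n → ℕ) → Ω → ℕ → ℝ≥0) (hξ : IsCascade P k x ξ)
    (η : ℕ → Ω' → ℕ → ℝ≥0) (hη : ∀ n ∈ Finset.Icc 1 k, IsREM P' (x n) (η n)) :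
    (∀ᵐ ω ∂P, 0 < cascadePartition ξ ω ∧ cascadePartition ξ ω < ∞) ∧
    IdentDistrib (cascadePartition ξ)
      (fun ω' => remPartition (η 1 ω') *
        ∏ n ∈ Finset.Icc 2 k,
          (∫⁻ ω'', remPartition (η n ω'') ^ x (n - 1) ∂P') ^ (1 / x (n - 1))) P P' ∧
    Integrable (fun ω => Real.log (cascadePartition ξ ω).toReal) P := by
  have hmono := hx_mono.monotoneOn
  have h1k : 1 ≤ k := by omega
  have hpos (n : ℕ) (hn : n ∈ Finset.Icc 1 k) : 0 < x n := by
    rw [Finset.mem_Icc] at hn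
    exact hx_pos.trans_le (hmono ⟨le_rfl, h1k⟩ hn hn.1)
  have hlt (n : ℕ) (hn : n ∈ Finset.Icc 1 k) : x n < 1 := by
    rw [Finset.mem_Icc] at hn
    exact (hmono hn ⟨h1k, le_rfl⟩ hn.2).trans_lt hx_lt
  have h1 : 1 ∈ Finset.Icc 1 k := by simpa using h1k
  have hη1 := hη 1 h1
  have hx1 := hlt 1 h1
  set M : ℝ≥0∞ := ∏ n ∈ Finset.Icc 2 k,
    (∫⁻ ω'', remPartition (η n ω'') ^ x (n - 1) ∂P') ^ (1 / x (n - 1)) with hM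
  have hmom (n : ℕ) (hn : n ∈ Finset.Icc 2 k) :
      (∫⁻ ω'', remPartition (η n ω'') ^ x (n - 1) ∂P') ≠ 0 ∧
      (∫⁻ ω'', remPartition (η n ω'') ^ x (n - 1) ∂P') ≠ ∞ ∧ 0 < x (n - 1) := by
    have hn1 : n ∈ Finset.Icc 1 k := by simp at hn ⊢; omega
    have hn0 : n - 1 ∈ Finset.Icc 1 k := by simp at hn ⊢; omega
    have hs : x (n - 1) < x n := by
      rw [Finset.mem_Icc] at hn hn1 hn0
      exact hx_mono hn0 hn1 (by omega)
    exact ⟨(hη n hn1).lintegral_remPartition_rpow_ne_zero (hpos _ hn0) (hpos _ hn1),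
      (hη n hn1).lintegral_remPartition_rpow_ne_top (hpos _ hn0) hs (hlt _ hn1), hpos _ hn0⟩
  have hM0 : M ≠ 0 := by
    rw [hM, Finset.prod_ne_zero_iff]
    intro n hn
    obtain ⟨a, b, c⟩ := hmom n hn
    simp [ENNReal.rpow_eq_zero_iff, a, b]
  have hMtop : M ≠ ∞ := by
    refine ENNReal.prod_ne_top fun n hn => ?_
    obtain ⟨a, b, c⟩ := hmom n hn
    simp [ENNReal.rpow_eq_top_iff, a, b]
  have hid : IdentDistrib (cascadePartition ξ) (fun ω' => remPartition (η 1 ω') * M) P P' := by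
    have e : remProduct P' k x η = fun ω' => remPartition (η 1 ω') * M := by
      ext ω'
      rw [remProduct, if_neg (by omega)]
    refine ⟨hξ.measurable.aemeasurable, (hη1.measurable_remPartition.mul_const _).aemeasurable, ?_⟩
    rw [hξ.map_cascadePartition hpos hη, e]
  have hae : ∀ᵐ ω' ∂P', remPartition (η 1 ω') * M ∈ Set.Ioo 0 ∞ := by
    filter_upwards [hη1.ae_remPartition_pos hx_pos, hη1.ae_remPartition_lt_top hx_pos hx1]
      with ω' h0 ht
    exact ⟨ENNReal.mul_pos h0.ne' hM0, ENNReal.mul_lt_top ht hMtop.lt_top⟩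
  refine ⟨hid.symm.ae_mem_snd measurableSet_Ioo hae, hid, ?_⟩
  have hlog : Measurable fun z : ℝ≥0∞ => Real.log z.toReal := by fun_prop
  refine (hid.comp hlog).integrable_iff.2 ?_
  refine ((hη1.integrable_log_remPartition hx_pos hx1).add
    (integrable_const (Real.log M.toReal))).congr ?_
  filter_upwards [hη1.ae_remPartition_pos hx_pos, hη1.ae_remPartition_lt_top hx_pos hx1]
    with ω' h0 ht
  simp only [Pi.add_apply, Function.comp_apply, ENNReal.toReal_mul]
  rw [Real.log_mul (ENNReal.toReal_pos h0.ne' ht.ne).ne' (ENNReal.toReal_pos hM0 hMtop).ne']
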